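/- Let $\Delta$ be an (abstract, possibly infinite) simplicial complex and let $m\ge 0$, $k\ge 1$ be integers. A finite set $\sigma$ of $l+1$ vertices of $\Delta$ ($l\ge -1$) is an \emph{$m$-pseudosimplex of dimension $l$} if every nonempty subset of $\sigma$ with at most $m+1$ elements spans a simplex of $\Delta$; subsets of $\sigma$ are then called \emph{pseudofaces} of $\sigma$, and a pseudoface with $d+1$ elements is called a $d$-pseudoface. Two finite vertex sets are \emph{$m$-joinable} if their union is an $m$-pseudosimplex. The complex $\Delta$ is \emph{$m$-flag with respect to} an $m$-pseudosimplex $\sigma$ if every $m$-pseudosimplex $\rho$ of $\Delta$ and every pseudoface $\tau$ of $\sigma$ such that $\{v,w\}$ spans a simplex of $\Delta$ for all $v\in\rho$, $w\in\tau$ are $m$-joinable. Suppose that there is an $m$-pseudosimplex $\sigma$ of dimension $l$ such that $\Delta$ is $m$-flag with respect to $\sigma$, and such that for every vertex $v$ of $\Delta$ the set $\{v\}$ is $m$-joinable to some $(l-k)$-pseudoface of $\sigma$. Then (the geometric realization of) $\Delta$ is $\min\{\lfloor l/k\rfloor-1,\,m-1\}$-connected. Here a space $X$ is $n$-connected if it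 is nonempty (when $n\ge -1$) and every continuous map $S^i\to X$ with $0\le i\le n$ extends to a continuous map $D^{i+1}\to X$; for $n\le -2$ the condition is empty. -/

import Mathlib

namespace AbstractSimplicialComplex

variable {V : Type*}

section Combinatorics

/-- A finite set `σ` of vertices is an `m`-pseudosimplex if every (nonempty) subset of at most
`m + 1` of its vertices spans a simplex. -/
def IsPseudosimplex (Δ : AbstractSimplicialComplex V) (m : ℕ) (σ : Finset V) : Prop :=
  ∀ τ : Finset V, τ ⊆ σ → τ.Nonempty → τ.card ≤ m + 1 → τ ∈ Δ

/-- An `m`-pseudosimplex of dimension `l`: an `m`-pseudosimplex with exactly `l + 1` vertices.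
The value `l = -1` is allowed and corresponds to `σ = ∅`. -/
def IsPseudosimplexOfDim (Δ : AbstractSimplicialComplex V) (m : ℕ) (l : ℤ) (σ : Finset V) : Prop :=
  (σ.card : ℤ) = l + 1 ∧ Δ.IsPseudosimplex m σ

/-- Two finite vertex sets are `m`-joinable if their union is an `m`-pseudosimplex. -/
def Joinable [DecidableEq V] (Δ : AbstractSimplicialComplex V) (m : ℕ) (σ τ : Finset V) : Prop :=
  Δ.IsPseudosimplex m (σ ∪ τ)

/-- Two vertex sets are vertex-wise joinable if every vertex of the first is joined to every
vertex of the second; a vertex counts as joined to itself (`{v, v} = {v}` is a simplex). -/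
def VertexwiseJoinable [DecidableEq V] (Δ : AbstractSimplicialComplex V) (ρ τ : Finset V) : Prop :=
  ∀ v ∈ ρ, ∀ w ∈ τ, ({v, w} : Finset V) ∈ Δ

/-- `Δ` is `m`-flag with respect to `σ`: every `m`-pseudosimplex `ρ` of `Δ` and every
pseudoface (i.e. subset) `τ` of `σ` that are vertex-wise joinable are `m`-joinable. -/
def IsFlagWithRespectTo [DecidableEq V] (Δ : AbstractSimplicialComplex V) (m : ℕ)
    (σ : Finset V) : Prop :=
  ∀ ρ τ : Finset V, Δ.IsPseudosimplex m ρ → τ ⊆ σ → Δ.VertexwiseJoinable ρ τ → Δ.Joinable m ρ τ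

end Combinatorics

section Realization

/-- The geometric realization of `Δ`, in barycentric coordinates: finitely supported functions
`x : V → [0, ∞)` with sum `1` whose support is a simplex of `Δ`. -/
def Realization (Δ : AbstractSimplicialComplex V) : Type _ :=
  {x : V →₀ ℝ // (∀ v, 0 ≤ x v) ∧ x.sum (fun _ t => t) = 1 ∧ x.support ∈ Δ}

/-- The closed simplex of the realization spanned by the vertices in `s`. -/
def closedSimplex (Δ : AbstractSimplicialComplex V) (s : Finset V) : Set Δ.Realization :=
  {x | x.1.support ⊆ s}

/-- The Euclidean topology of a closed simplex, i.e. the topology induced by the barycentric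
coordinates. -/
abbrev closedSimplexTopology (Δ : AbstractSimplicialComplex V) (s : Finset V) :
    TopologicalSpace (Δ.closedSimplex s) :=
  TopologicalSpace.induced (fun (x : Δ.closedSimplex s) (v : V) => x.1.1 v) Pi.topologicalSpace

/-- The weak topology: a subset of the realization is open (closed) iff its intersection with
every closed simplex is open (closed) in that simplex. -/
instance (Δ : AbstractSimplicialComplex V) : TopologicalSpace Δ.Realization :=
  ⨆ s ∈ Δ.faces, TopologicalSpace.coinduced Subtype.val (Δ.closedSimplexTopology s)

end Realization

end AbstractSimplicialComplex

/-- A topological space `X` is `n`-connected (`n : ℤ`) if it is nonempty when `n ≥ -1`, and for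
all `0 ≤ i ≤ n` every continuous map from the sphere `S^i` to `X` extends continuously to the ball
`D^(i+1)`. For `n ≤ -2` the condition is empty. -/
def IsNConnected (n : ℤ) (X : Type*) [TopologicalSpace X] : Prop :=
  (-1 ≤ n → Nonempty X) ∧
    ∀ i : ℕ, (i : ℤ) ≤ n →
      ∀ f : C(Metric.sphere (0 : EuclideanSpace ℝ (Fin (i + 1))) 1, X),
        ∃ g : C(Metric.closedBall (0 : EuclideanSpace ℝ (Fin (i + 1))) 1, X),
          ∀ x : Metric.sphere (0 : EuclideanSpace ℝ (Fin (i + 1))) 1,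
            g ⟨x.1, Metric.sphere_subset_closedBall x.2⟩ = f x

/-! ### Topology of the realization. -/

namespace AbstractSimplicialComplex

variable {V : Type*}

/-! Put `n = i + 1`. Each vertex is joined to all but at most `k` vertices of `σ`, and `n * k ≤ l <
|σ|`, so any `n` vertices have a common neighbour in `σ` (`exists_common_neighbor`). This is used to
push a sphere into `σ` and cone it off there.

Replace `S^i` by the boundary of the cube in `ℝ^n`. A fine Kuhn triangulation gives bump functions
`u j`, at most `n` of them positive at any point (`card_le_of_kuhnHat_pos`), and vertices `v j`
lying in the support of `f x` whenever `u j x > 0`. A straight-line homotopy takes `f` to the map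
with weights `u j` on the `v j`.

For each set `τ` of at most `n` indices choose `G τ ∈ σ` joined to all `v j`, `j ∈ τ`. The
superlevel sets of `j ↦ u j x` form a chain, as in a barycentric subdivision, and `chainWeight`
turns them into weights on the vertices `G τ`. Truncating `u` at height `t` interpolates between the
two maps (`homotopic_chainWeight`): the part above `t` stays on the `v j`, the part below goes to
the `G τ`. The sets `τ` in use contain every index above `t`, so `m`-flagness applies, and at most
`n + 1 ≤ m + 1` vertices occur. The final map uses at most `n` vertices of `σ` at a time, which
leaves room for a cone point (`nullhomotopic_chainWeight`). -/

theorem mem_of_subset {Δ : AbstractSimplicialComplex V} {s t : Finset V} (hs : s ∈ Δ)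
    (hts : t ⊆ s) (ht : t.Nonempty) : t ∈ Δ :=
  (Δ.isRelLowerSet_faces hs).2 hts ht

theorem continuous_realization_dom {Δ : AbstractSimplicialComplex V} {Y : Type*}
    [TopologicalSpace Y] {h : Δ.Realization → Y}
    (H : ∀ s ∈ Δ, @Continuous _ _ (Δ.closedSimplexTopology s) _
      (fun x : Δ.closedSimplex s => h x.1)) : Continuous h := by
  refine continuous_iSup_dom.2 fun s => continuous_iSup_dom.2 fun hs => ?_
  exact continuous_coinduced_dom.2 (H s hs)

theorem continuous_closedSimplex_val (Δ : AbstractSimplicialComplex V) {s : Finset V}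
    (hs : s ∈ Δ) :
    @Continuous _ _ (Δ.closedSimplexTopology s) _
      (Subtype.val : Δ.closedSimplex s → Δ.Realization) := by
  refine continuous_iff_coinduced_le.2 ?_
  exact le_iSup₂ (f := fun (s : Finset V) (_ : s ∈ Δ.faces) =>
    TopologicalSpace.coinduced Subtype.val (Δ.closedSimplexTopology s)) s hs

/-- Every linear function of the barycentric coordinates is continuous on the realization. -/
theorem continuous_sum_mul_coord (Δ : AbstractSimplicialComplex V) (c : V → ℝ) :
    Continuous fun x : Δ.Realization => x.1.sum fun v t => c v * t := by
  refine continuous_realization_dom fun s _ => ?_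
  let _ := Δ.closedSimplexTopology s
  have h : (fun x : Δ.closedSimplex s => x.1.1.sum fun v t => c v * t) =
      fun x => ∑ v ∈ s, c v * x.1.1 v := by
    funext x
    exact Finsupp.sum_of_support_subset _ x.2 _ (by simp)
  rw [h]
  refine continuous_finsetSum _ fun v _ => continuous_const.mul ?_
  exact (continuous_apply v).comp continuous_induced_dom

theorem continuous_coord (Δ : AbstractSimplicialComplex V) (v : V) :
    Continuous fun x : Δ.Realization => x.1 v := by
  classical
  convert Δ.continuous_sum_mul_coord (Pi.single v 1) using 2 with x
  rw [Finsupp.sum_of_support_subset (s := insert v x.1.support) _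
    (Finset.subset_insert _ _) _ (by simp), Finset.sum_eq_single v]
  · simp
  · intro w _ hw
    simp [hw]
  · simp

/-- A continuous map from a compact space to the realization meets only finitely many open
stars of vertices. -/
theorem exists_finset_support_subset {Δ : AbstractSimplicialComplex V} {S : Type*}
    [TopologicalSpace S] [CompactSpace S] (f : C(S, Δ.Realization)) :
    ∃ W : Finset V, ∀ x, (f x).1.support ⊆ W := by
  classical
  by_contra hW
  have hinf : {v : V | ∃ x, v ∈ (f x).1.support}.Infinite := by
    intro hfin
    exact hW ⟨hfin.toFinset, fun x v hv => by
      rw [Set.Finite.mem_toFinset]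
      exact ⟨x, hv⟩⟩
  let e := hinf.natEmbedding
  choose p hp using fun i => (e i).2
  have hpos : ∀ i, 0 < (f (p i)).1 (e i) := fun i =>
    lt_of_le_of_ne ((f (p i)).2.1 _) (Ne.symm (Finsupp.mem_support_iff.1 (hp i)))
  let E : ℕ → V := fun i => (e i : V)
  have hE : Function.Injective E := Subtype.val_injective.comp e.injective
  -- The coefficients make this linear function at least `i` at `f (p i)`, contradicting boundedness
  -- on a compact image.
  let c : V → ℝ := Function.extend E (fun i => (i : ℝ) / (f (p i)).1 (e i)) 0
  have hc : ∀ i, c (E i) = (i : ℝ) / (f (p i)).1 (e i) := fun i => hE.extend_apply _ _ i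
  have hc0 : ∀ v, 0 ≤ c v := by
    intro v
    by_cases hv : ∃ i, E i = v
    · obtain ⟨i, rfl⟩ := hv
      rw [hc]
      exact div_nonneg i.cast_nonneg (hpos i).le
    · simp [c, Function.extend_apply' _ _ _ hv]
  have hcont := (Δ.continuous_sum_mul_coord c).comp f.continuous
  obtain ⟨B, hB⟩ := (isCompact_range hcont).bddAbove
  obtain ⟨i, hi⟩ := exists_nat_gt B
  refine hi.not_ge ((?_ : (i : ℝ) ≤ _).trans (hB ⟨p i, rfl⟩))
  have h1 : c (E i) * (f (p i)).1 (E i) = i := by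
    rw [hc]
    exact div_mul_cancel₀ _ (hpos i).ne'
  rw [← h1]
  exact Finset.single_le_sum (f := fun v => c v * (f (p i)).1 v)
    (fun v _ => mul_nonneg (hc0 v) ((f (p i)).2.1 v)) (hp i)

/-- The finitely many faces inside `W` give a finite closed cover of `Y`. On each piece the map
lands in one closed simplex, where continuity is coordinatewise. -/
theorem continuous_of_support_subset {Δ : AbstractSimplicialComplex V} {Y : Type*}
    [TopologicalSpace Y] {F : Y → Δ.Realization} (W : Finset V)
    (hW : ∀ y, (F y).1.support ⊆ W) (hF : ∀ v, Continuous fun y => (F y).1 v) :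
    Continuous F := by
  classical
  let ι := {s : Finset V // s ∈ W.powerset ∧ s ∈ Δ}
  have : Finite ι := (W.powerset.finite_toSet.subset
    (fun s (hs : s ∈ W.powerset ∧ s ∈ Δ) => hs.1)).to_subtype
  refine (locallyFinite_of_finite fun s : ι => {y | (F y).1.support ⊆ s.1}).continuous ?_ ?_ ?_
  · refine Set.eq_univ_of_forall fun y => Set.mem_iUnion.2 ?_
    exact ⟨⟨_, Finset.mem_powerset.2 (hW y), (F y).2.2.2⟩, Finset.Subset.refl _⟩
  · intro s
    have : {y | (F y).1.support ⊆ s.1} = ⋂ v ∈ {v | v ∉ s.1}, {y | (F y).1 v = 0} := by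
      ext y
      simp only [Set.mem_ofPred_eq, Set.mem_iInter]
      constructor
      · intro h v hv
        by_contra h0
        exact hv (h (Finsupp.mem_support_iff.2 h0))
      · intro h v hv
        by_contra h0
        exact Finsupp.mem_support_iff.1 hv (h v h0)
    rw [this]
    exact isClosed_biInter fun v _ => isClosed_eq (hF v) continuous_const
  · intro s
    rw [continuousOn_iff_continuous_domRestrict]
    let _ := Δ.closedSimplexTopology s.1
    let F' : {y | (F y).1.support ⊆ s.1} → Δ.closedSimplex s.1 := fun y => ⟨F y.1, y.2⟩
    have hF' : Continuous F' := continuous_induced_rng.2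
      (continuous_pi fun v => (hF v).comp continuous_subtype_val)
    exact (Δ.continuous_closedSimplex_val s.2.2).comp hF'

/-- The weights `a` on the vertices `v` have a positive total and live on a simplex of `Δ`. -/
structure IsWeight (Δ : AbstractSimplicialComplex V) {J : Type*} (v : J → V) (a : J → ℝ) :
    Prop where
  nonneg : ∀ j, 0 ≤ a j
  exists_pos : ∃ j, 0 < a j
  exists_face : ∃ s ∈ Δ, ∀ j, 0 < a j → v j ∈ s

/-! ### Points and homotopies given by weights, normalised only at the end. -/

section Weights

variable {Δ : AbstractSimplicialComplex V} {J : Type*} [Fintype J] {v : J → V}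

theorem IsWeight.sum_pos {a : J → ℝ} (h : Δ.IsWeight v a) : 0 < ∑ j, a j :=
  Finset.sum_pos' (fun j _ => h.nonneg j) (h.exists_pos.imp fun j hj => ⟨Finset.mem_univ j, hj⟩)

variable (v) in
/-- The finitely supported function with normalised weights `a` on the vertices `v`. -/
noncomputable def weightCoord (a : J → ℝ) : V →₀ ℝ :=
  (∑ j, a j)⁻¹ • ∑ j, Finsupp.single (v j) (a j)

theorem weightCoord_apply [DecidableEq V] (a : J → ℝ) (w : V) :
    weightCoord v a w = (∑ j, a j)⁻¹ * ∑ j, if v j = w then a j else 0 := by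
  simp [weightCoord, Finsupp.single_apply]

/-- The point of the realization with normalised weights `a` on the vertices `v`. -/
noncomputable def ofWeights (a : J → ℝ) (h : Δ.IsWeight v a) : Δ.Realization := by
  classical
  refine ⟨weightCoord v a, ?_, ?_, ?_⟩
  · intro w
    rw [weightCoord_apply]
    exact mul_nonneg (inv_nonneg.2 h.sum_pos.le)
      (Finset.sum_nonneg fun j _ => by split_ifs <;> simp [h.nonneg])
  · have hsum : ∀ x : V →₀ ℝ, x.sum (fun _ t => t) =
        Finsupp.linearCombination ℝ (fun _ => (1 : ℝ)) x := by
      intro x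
      simp [Finsupp.linearCombination_apply]
    rw [hsum, weightCoord, map_smul, map_sum]
    simp [inv_mul_cancel₀ h.sum_pos.ne']
  · obtain ⟨s, hs, hjs⟩ := h.exists_face
    refine mem_of_subset hs ?_ ?_
    · intro w hw
      rw [Finsupp.mem_support_iff, weightCoord_apply] at hw
      obtain ⟨j, -, hj⟩ := Finset.exists_ne_zero_of_sum_ne_zero (right_ne_zero_of_mul hw)
      split_ifs at hj with hjw
      · exact hjw ▸ hjs j (lt_of_le_of_ne (h.nonneg j) (Ne.symm hj))
      · exact absurd rfl hj
    · obtain ⟨j, hj⟩ := h.exists_pos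
      refine ⟨v j, ?_⟩
      rw [Finsupp.mem_support_iff, weightCoord_apply]
      refine (mul_pos (inv_pos.2 h.sum_pos) ?_).ne'
      refine Finset.sum_pos' (fun i _ => by split_ifs <;> simp [h.nonneg])
        ⟨j, Finset.mem_univ j, by simpa using hj⟩

theorem ofWeights_val (a : J → ℝ) (h : Δ.IsWeight v a) :
    (ofWeights a h).1 = weightCoord v a := by
  rfl

theorem continuous_ofWeights {Y : Type*} [TopologicalSpace Y] {a : Y → J → ℝ}
    (h : ∀ y, Δ.IsWeight v (a y)) (ha : ∀ j, Continuous fun y => a y j) :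
    Continuous fun y => ofWeights (a y) (h y) := by
  classical
  refine continuous_of_support_subset (Finset.univ.image v) ?_ ?_
  · intro y w hw
    rw [ofWeights_val, Finsupp.mem_support_iff, weightCoord_apply] at hw
    obtain ⟨j, -, hj⟩ := Finset.exists_ne_zero_of_sum_ne_zero (right_ne_zero_of_mul hw)
    split_ifs at hj with hjw
    · exact Finset.mem_image.2 ⟨j, Finset.mem_univ j, hjw⟩
    · exact absurd rfl hj
  · intro w
    simp only [ofWeights_val, weightCoord_apply]
    refine ((continuous_finsetSum _ fun j _ => ha j).inv₀ fun y => (h y).sum_pos.ne').mul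
      (continuous_finsetSum _ fun j _ => ?_)
    split_ifs
    · exact ha j
    · exact continuous_const

/-- A continuous family of weights gives a homotopy of maps into the realization. -/
theorem homotopic_of_weights {S : Type*} [TopologicalSpace S] {f₀ f₁ : C(S, Δ.Realization)}
    (a : unitInterval → S → J → ℝ) (h : ∀ t x, Δ.IsWeight v (a t x))
    (ha : ∀ j, Continuous fun p : unitInterval × S => a p.1 p.2 j)
    (h₀ : ∀ x, (f₀ x).1 = weightCoord v (a 0 x)) (h₁ : ∀ x, (f₁ x).1 = weightCoord v (a 1 x)) :
    f₀.Homotopic f₁ :=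
  ⟨{ toFun := fun p : unitInterval × S => ofWeights (a p.1 p.2) (h p.1 p.2)
     continuous_toFun := continuous_ofWeights (fun p : unitInterval × S => h p.1 p.2) ha
     map_zero_left := fun x => Subtype.ext (h₀ x).symm
     map_one_left := fun x => Subtype.ext (h₁ x).symm }⟩

end Weights

end AbstractSimplicialComplex

/-- A weight of a set `τ` of indices that is positive exactly if `τ` is a nonempty strict
superlevel set of the nonnegative function `b`. -/
noncomputable def chainWeight {J : Type*} [Fintype J] [DecidableEq J] (b : J → ℝ)
    (τ : Finset J) : ℝ :=
  if τ.Nonempty then (∏ j ∈ τ, b j) * ∏ j ∈ τ, ∏ k ∈ τᶜ, max (b j - b k) 0 else 0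

/-! ### Superlevel sets as a barycentric subdivision. -/

section ChainWeight

variable {J : Type*} [Fintype J] [DecidableEq J] {b : J → ℝ}

theorem chainWeight_nonneg (hb : ∀ j, 0 ≤ b j) (τ : Finset J) : 0 ≤ chainWeight b τ := by
  unfold chainWeight
  split_ifs
  · exact mul_nonneg (Finset.prod_nonneg fun j _ => hb j)
      (Finset.prod_nonneg fun j _ => Finset.prod_nonneg fun k _ => le_max_right _ _)
  · exact le_rfl

theorem chainWeight_pos_iff (hb : ∀ j, 0 ≤ b j) {τ : Finset J} :
    0 < chainWeight b τ ↔
      τ.Nonempty ∧ (∀ j ∈ τ, 0 < b j) ∧ ∀ j ∈ τ, ∀ k ∉ τ, b k < b j := by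
  rw [(chainWeight_nonneg hb τ).lt_iff_ne']
  unfold chainWeight
  have h1 : ∀ j k, max (b j - b k) 0 ≠ 0 ↔ b k < b j := by
    intro j k
    rw [ne_eq, max_eq_right_iff, not_le, sub_pos]
  have h2 : ∀ j, b j ≠ 0 ↔ 0 < b j := fun j => (hb j).lt_iff_ne'.symm
  split_ifs with hτ
  · simp only [mul_ne_zero_iff, Finset.prod_ne_zero_iff, h1, h2, Finset.mem_compl, hτ, true_and]
  · simp [hτ]

theorem exists_chainWeight_pos (hb : ∀ j, 0 ≤ b j) (h : ∃ j, 0 < b j) :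
    ∃ τ, 0 < chainWeight b τ := by
  obtain ⟨j, hj⟩ := h
  obtain ⟨i, -, hi⟩ := Finset.exists_max_image Finset.univ b ⟨j, Finset.mem_univ j⟩
  -- The set where `b` attains its maximum is the smallest nonempty superlevel set.
  refine ⟨Finset.univ.filter fun k => b k = b i, (chainWeight_pos_iff hb).2 ⟨⟨i, by simp⟩, ?_, ?_⟩⟩
  · intro k hk
    rw [(Finset.mem_filter.1 hk).2]
    exact hj.trans_le (hi j (Finset.mem_univ j))
  · intro k hk k' hk'
    rw [(Finset.mem_filter.1 hk).2]
    exact lt_of_le_of_ne (hi k' (Finset.mem_univ k')) (by simpa using hk')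

theorem chainWeight_zero (τ : Finset J) : chainWeight (0 : J → ℝ) τ = 0 := by
  unfold chainWeight
  split_ifs with h
  · simp [h.card_ne_zero]
  · rfl

theorem continuous_chainWeight (τ : Finset J) :
    Continuous fun b : J → ℝ => chainWeight b τ := by
  unfold chainWeight
  split_ifs <;> fun_prop

/-- Indices `j ∈ τ \ τ'` and `k ∈ τ' \ τ` would satisfy both `b k < b j` and `b j < b k`. -/
theorem chainWeight_subset_or_subset (hb : ∀ j, 0 ≤ b j) {τ τ' : Finset J}
    (h : 0 < chainWeight b τ) (h' : 0 < chainWeight b τ') : τ ⊆ τ' ∨ τ' ⊆ τ := by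
  by_contra! hcon
  obtain ⟨j, hj, hj'⟩ := Finset.not_subset.1 hcon.1
  obtain ⟨k, hk, hk'⟩ := Finset.not_subset.1 hcon.2
  exact lt_asymm (((chainWeight_pos_iff hb).1 h).2.2 j hj k hk')
    (((chainWeight_pos_iff hb).1 h').2.2 k hk j hj')

end ChainWeight

/-- A chain of finite sets whose cardinalities lie between `p` and `q` has at most `q + 1 - p`
members. -/
theorem card_chain_le {J : Type*} {C : Finset (Finset J)} {p q : ℕ}
    (hC : ∀ τ ∈ C, ∀ τ' ∈ C, τ ⊆ τ' ∨ τ' ⊆ τ) (hp : ∀ τ ∈ C, p ≤ τ.card)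
    (hq : ∀ τ ∈ C, τ.card ≤ q) : C.card ≤ q + 1 - p := by
  rw [← Nat.card_Icc]
  refine Finset.card_le_card_of_injOn Finset.card
    (fun τ hτ => Finset.mem_coe.2 (Finset.mem_Icc.2 ⟨hp τ hτ, hq τ hτ⟩)) ?_
  intro τ hτ τ' hτ' h
  rcases hC τ hτ τ' hτ' with h' | h'
  · exact Finset.eq_of_subset_of_card_le h' h.ge
  · exact (Finset.eq_of_subset_of_card_le h' h.le).symm

/-! ### Deforming a map into the pseudosimplex and contracting it there. -/

namespace AbstractSimplicialComplex

variable {V : Type*} {Δ : AbstractSimplicialComplex V}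

theorem weightCoord_sumElim_zero_right {J K : Type*} [Fintype J] [Fintype K] (v : J → V)
    (v' : K → V) (a : J → ℝ) :
    weightCoord (Sum.elim v v') (Sum.elim a 0) = weightCoord v a := by
  simp [weightCoord]

theorem weightCoord_sumElim_zero_left {J K : Type*} [Fintype J] [Fintype K] (v : J → V)
    (v' : K → V) (a : K → ℝ) :
    weightCoord (Sum.elim v v') (Sum.elim 0 a) = weightCoord v' a := by
  simp [weightCoord]

theorem weightCoord_coord (x : Δ.Realization) {W : Finset V} (hW : x.1.support ⊆ W) :
    weightCoord (fun w : W => (w : V)) (fun w => x.1 w) = x.1 := by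
  have h1 : ∑ w ∈ W, x.1 w = 1 := by
    refine Eq.trans ?_ x.2.2.1
    exact (Finsupp.sum_of_support_subset _ hW (fun _ t => t) fun _ _ => rfl).symm
  have h2 : ∑ w ∈ W, Finsupp.single w (x.1 w) = x.1 := by
    conv_rhs => rw [← Finsupp.sum_single x.1]
    exact (Finsupp.sum_of_support_subset _ hW _ (by simp)).symm
  rw [weightCoord, Finset.sum_coe_sort W fun w => x.1 w,
    Finset.sum_coe_sort W fun w => Finsupp.single w (x.1 w), h1, h2, inv_one, one_smul]

section Contraction

variable {S : Type*} [TopologicalSpace S] {f : C(S, Δ.Realization)}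
  {J : Type*} [Fintype J] {u : J → C(S, ℝ)} {v : J → V}

/-- The straight-line homotopy from a map to a simplicial approximation. -/
theorem homotopic_simplicialApproximation [CompactSpace S]
    (hu : ∀ x, Δ.IsWeight v fun j => u j x)
    (hv : ∀ j x, 0 < u j x → v j ∈ (f x).1.support) :
    f.Homotopic ⟨fun x => ofWeights (fun j => u j x) (hu x),
      continuous_ofWeights hu fun j => (u j).continuous⟩ := by
  obtain ⟨W, hW⟩ := exists_finset_support_subset f
  -- Both endpoints use only vertices of the support of `f x`, so the whole segment lies in that
  -- simplex.
  refine homotopic_of_weights (v := Sum.elim (fun w : W => (w : V)) v)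
    (fun t x => Sum.elim (fun w : W => (1 - (t : ℝ)) * (f x).1 w) fun j => (t : ℝ) * u j x)
    (fun t x => ⟨?_, ?_, ?_⟩) ?_ ?_ ?_
  · rintro (w | j)
    · exact mul_nonneg (sub_nonneg.2 t.2.2) ((f x).2.1 w)
    · exact mul_nonneg t.2.1 ((hu x).nonneg j)
  · rcases t.2.1.eq_or_lt with ht | ht
    · obtain ⟨w, hw⟩ := (Δ.isRelLowerSet_faces (f x).2.2.2).1
      refine ⟨Sum.inl ⟨w, hW x hw⟩, ?_⟩
      simpa [← ht] using
        lt_of_le_of_ne ((f x).2.1 w) (Ne.symm (Finsupp.mem_support_iff.1 hw))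
    · obtain ⟨j, hj⟩ := (hu x).exists_pos
      exact ⟨Sum.inr j, mul_pos ht hj⟩
  · refine ⟨(f x).1.support, (f x).2.2.2, ?_⟩
    rintro (w | j) h
    · exact Finsupp.mem_support_iff.2 (right_ne_zero_of_mul (ne_of_gt h))
    · exact hv j x (lt_of_le_of_ne ((hu x).nonneg j) (Ne.symm (right_ne_zero_of_mul (ne_of_gt h))))
  · rintro (w | j)
    · have := (Δ.continuous_coord w).comp f.continuous
      have h2 : Continuous fun p : unitInterval × S => (f p.2).1 w := this.comp continuous_snd
      simp only [Sum.elim_inl]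
      fun_prop
    · simp only [Sum.elim_inr]
      fun_prop
  · intro x
    refine (weightCoord_coord (f x) (hW x)).symm.trans ?_
    rw [← weightCoord_sumElim_zero_right _ v]
    congr 1
    funext k
    rcases k with w | j <;> simp
  · intro x
    rw [ContinuousMap.coe_mk, ofWeights_val,
      ← weightCoord_sumElim_zero_left (fun w : W => (w : V)) v]
    congr 1
    funext k
    rcases k with w | j <;> simp

variable [DecidableEq V] [DecidableEq J] {m n : ℕ} {σ : Finset V} {G : Finset J → V}

/-- The homotopy that replaces a simplicial map by a map into the pseudosimplex `σ`, moving
through the simplices spanned by the vertices of high weight and vertices of `σ` joined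
to them. -/
theorem homotopic_chainWeight (hnm : n ≤ m) (hflag : Δ.IsFlagWithRespectTo m σ)
    (hG : ∀ τ, G τ ∈ σ) (hGv : ∀ τ : Finset J, τ.card ≤ n → ∀ j ∈ τ, {v j, G τ} ∈ Δ)
    (hu : ∀ x, Δ.IsWeight v fun j => u j x) (hu1 : ∀ j x, u j x ≤ 1)
    (hord : ∀ x, (Finset.univ.filter fun j => 0 < u j x).card ≤ n)
    (hc : ∀ x, Δ.IsWeight G (chainWeight fun j => u j x)) :
    ContinuousMap.Homotopic
      (⟨fun x => ofWeights (fun j => u j x) (hu x),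
        continuous_ofWeights hu fun j => (u j).continuous⟩ : C(S, Δ.Realization))
      ⟨fun x => ofWeights (chainWeight fun j => u j x) (hc x),
        continuous_ofWeights hc fun τ => (continuous_chainWeight τ).comp
          (continuous_pi fun j => (u j).continuous)⟩ := by
  have hb : ∀ (t : unitInterval) x j, 0 ≤ min (u j x) (t : ℝ) := fun t x j =>
    le_min ((hu x).nonneg j) t.2.1
  refine homotopic_of_weights (v := Sum.elim v G)
    (fun t x => Sum.elim (fun j => max (u j x - t) 0) (chainWeight fun j => min (u j x) t))
    (fun t x => ?_) ?_ ?_ ?_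
  · have hpos : ∃ k, 0 < (Sum.elim (fun j => max (u j x - t) 0)
        (chainWeight fun j => min (u j x) t) : J ⊕ Finset J → ℝ) k := by
      by_cases h : ∃ j, (t : ℝ) < u j x
      · obtain ⟨j, hj⟩ := h
        exact ⟨Sum.inl j, lt_max_of_lt_left (sub_pos.2 hj)⟩
      · push Not at h
        obtain ⟨τ, hτ⟩ := exists_chainWeight_pos (hu x).nonneg (hu x).exists_pos
        refine ⟨Sum.inr τ, ?_⟩
        simpa only [Sum.elim_inr, min_eq_left (h _)] using hτ
    refine ⟨?_, hpos, ?_⟩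
    · rintro (j | τ)
      · exact le_max_right _ _
      · exact chainWeight_nonneg (hb t x) τ
    set α : Finset J := Finset.univ.filter fun j => (t : ℝ) < u j x with hα
    set C : Finset (Finset J) :=
      Finset.univ.filter fun τ => 0 < chainWeight (fun j => min (u j x) t) τ with hC
    have hCpos : ∀ τ ∈ C, τ.Nonempty ∧ (∀ j ∈ τ, 0 < min (u j x) t) ∧
        ∀ j ∈ τ, ∀ k ∉ τ, min (u k x) (t : ℝ) < min (u j x) t := fun τ hτ =>
      (chainWeight_pos_iff (hb t x)).1 (Finset.mem_filter.1 hτ).2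
    have hcardC : ∀ τ ∈ C, τ.card ≤ n := fun τ hτ =>
      (Finset.card_le_card fun j hj => Finset.mem_filter.2
        ⟨Finset.mem_univ j, (lt_min_iff.1 ((hCpos τ hτ).2.1 j hj)).1⟩).trans (hord x)
    -- An index of `α` has the maximal truncated value `t`, so it cannot lie strictly below a member
    -- of `τ`.
    have hsub : ∀ τ ∈ C, α ⊆ τ := by
      intro τ hτ j hj
      by_contra hjτ
      obtain ⟨⟨k, hk⟩, -, h⟩ := hCpos τ hτ
      have h1 := h k hk j hjτ
      rw [min_eq_right (Finset.mem_filter.1 hj).2.le] at h1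
      exact absurd h1 (min_le_right _ _).not_gt
    have hmem : ∀ k, 0 < (Sum.elim (fun j => max (u j x - t) 0)
        (chainWeight fun j => min (u j x) t) : J ⊕ Finset J → ℝ) k →
        Sum.elim v G k ∈ α.image v ∪ C.image G := by
      rintro (j | τ) h
      · refine Finset.mem_union_left _ (Finset.mem_image_of_mem v (Finset.mem_filter.2
          ⟨Finset.mem_univ j, ?_⟩))
        simpa using h
      · exact Finset.mem_union_right _ (Finset.mem_image_of_mem G (Finset.mem_filter.2
          ⟨Finset.mem_univ τ, h⟩))
    refine ⟨α.image v ∪ C.image G, ?_, hmem⟩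
    have hαcard : α.card ≤ n :=
      (Finset.card_le_card fun j hj => Finset.mem_filter.2
        ⟨Finset.mem_univ j, t.2.1.trans_lt (Finset.mem_filter.1 hj).2⟩).trans (hord x)
    have hCcard : C.card ≤ n + 1 - α.card :=
      card_chain_le (fun τ hτ τ' hτ' => chainWeight_subset_or_subset (hb t x)
        (Finset.mem_filter.1 hτ).2 (Finset.mem_filter.1 hτ').2)
        (fun τ hτ => Finset.card_le_card (hsub τ hτ)) hcardC
    -- `α.image v` lies in a simplex of `Δ` and `C.image G` in `σ`. They are vertexwise joined
    -- because each `τ ∈ C` contains `α`, and together they have at most `|α| + (n + 1 - |α|) = n +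
    -- 1` vertices.
    refine hflag (α.image v) (C.image G) ?_ ?_ ?_ _ (Finset.Subset.refl _) ?_ ?_
    · intro ρ hρ hne _
      obtain ⟨s, hs, hvs⟩ := (hu x).exists_face
      refine mem_of_subset hs (hρ.trans fun w hw => ?_) hne
      obtain ⟨j, hj, rfl⟩ := Finset.mem_image.1 hw
      exact hvs j (t.2.1.trans_lt (Finset.mem_filter.1 hj).2)
    · intro w hw
      obtain ⟨τ, -, rfl⟩ := Finset.mem_image.1 hw
      exact hG τ
    · intro w hw w' hw'
      obtain ⟨j, hj, rfl⟩ := Finset.mem_image.1 hw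
      obtain ⟨τ, hτ, rfl⟩ := Finset.mem_image.1 hw'
      exact hGv τ (hcardC τ hτ) j (hsub τ hτ hj)
    · obtain ⟨k, hk⟩ := hpos
      exact ⟨_, hmem k hk⟩
    · have h1 := Finset.card_union_le (α.image v) (C.image G)
      have h2 : (α.image v).card ≤ α.card := Finset.card_image_le
      have h3 : (C.image G).card ≤ C.card := Finset.card_image_le
      omega
  · rintro (j | τ)
    · simp only [Sum.elim_inl]
      fun_prop
    · exact (continuous_chainWeight τ).comp (continuous_pi fun j => by fun_prop)
  · intro x
    rw [ContinuousMap.coe_mk, ofWeights_val, ← weightCoord_sumElim_zero_right v G]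
    congr 1
    funext k
    rcases k with j | τ
    · simp [(hu x).nonneg j]
    · have : (fun j => min (u j x) ((0 : unitInterval) : ℝ)) = 0 := by
        funext j
        simp [(hu x).nonneg j]
      rw [Sum.elim_inr, Sum.elim_inr, this, chainWeight_zero, Pi.zero_apply]
  · intro x
    rw [ContinuousMap.coe_mk, ofWeights_val, ← weightCoord_sumElim_zero_left v G]
    congr 1
    funext k
    rcases k with j | τ
    · simp [hu1 j x]
    · simp [hu1 _ x]

/-- A map with small support in the pseudosimplex `σ` can be coned off. -/
theorem nullhomotopic_chainWeight (hnm : n ≤ m) (hσ : Δ.IsPseudosimplex m σ)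
    (hG : ∀ τ, G τ ∈ σ) (hu : ∀ j x, 0 ≤ u j x)
    (hord : ∀ x, (Finset.univ.filter fun j => 0 < u j x).card ≤ n)
    (hc : ∀ x, Δ.IsWeight G (chainWeight fun j => u j x)) :
    ContinuousMap.Nullhomotopic
      (⟨fun x => ofWeights (chainWeight fun j => u j x) (hc x),
        continuous_ofWeights hc fun τ => (continuous_chainWeight τ).comp
          (continuous_pi fun j => (u j).continuous)⟩ : C(S, Δ.Realization)) := by
  -- `G ∅` serves merely as some vertex of `σ`, the apex of the cone.
  have hconst : Δ.IsWeight (fun _ : Unit => G ∅) fun _ => 1 :=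
    ⟨fun _ => zero_le_one, ⟨(), one_pos⟩, {G ∅}, Δ.singleton_mem _, by simp⟩
  refine ⟨ofWeights _ hconst, homotopic_of_weights (v := Sum.elim G fun _ : Unit => G ∅)
    (fun t x => Sum.elim (fun τ => (1 - (t : ℝ)) * chainWeight (fun j => u j x) τ)
      fun _ => (t : ℝ)) (fun t x => ⟨?_, ?_, ?_⟩) ?_ ?_ ?_⟩
  · rintro (τ | _)
    · exact mul_nonneg (sub_nonneg.2 t.2.2) (chainWeight_nonneg (fun j => hu j x) τ)
    · exact t.2.1
  · rcases t.2.1.eq_or_lt with ht | ht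
    · obtain ⟨τ, hτ⟩ := (hc x).exists_pos
      exact ⟨Sum.inl τ, by simpa [← ht] using hτ⟩
    · exact ⟨Sum.inr (), ht⟩
  · set C : Finset (Finset J) :=
      Finset.univ.filter fun τ => 0 < chainWeight (fun j => u j x) τ with hC
    have hCpos := fun τ (hτ : τ ∈ C) =>
      (chainWeight_pos_iff fun j => hu j x).1 (Finset.mem_filter.1 hτ).2
    -- Members of the chain are nonempty, so there are at most `n` of them; adding the apex stays
    -- within `m + 1`.
    have hCcard : C.card ≤ n + 1 - 1 :=
      card_chain_le (fun τ hτ τ' hτ' => chainWeight_subset_or_subset (fun j => hu j x)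
        (Finset.mem_filter.1 hτ).2 (Finset.mem_filter.1 hτ').2)
        (fun τ hτ => (hCpos τ hτ).1.card_pos) fun τ hτ =>
          (Finset.card_le_card fun j hj => Finset.mem_filter.2
            ⟨Finset.mem_univ j, (hCpos τ hτ).2.1 j hj⟩).trans (hord x)
    refine ⟨insert (G ∅) (C.image G), hσ _ ?_ (Finset.insert_nonempty _ _) ?_, ?_⟩
    · intro w hw
      rcases Finset.mem_insert.1 hw with rfl | hw
      · exact hG _
      · obtain ⟨τ, -, rfl⟩ := Finset.mem_image.1 hw
        exact hG τ
    · have h1 := Finset.card_insert_le (G ∅) (C.image G)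
      have h2 : (C.image G).card ≤ C.card := Finset.card_image_le
      omega
    · rintro (τ | _) h
      · refine Finset.mem_insert_of_mem (Finset.mem_image_of_mem G (Finset.mem_filter.2
          ⟨Finset.mem_univ τ, ?_⟩))
        exact lt_of_le_of_ne (chainWeight_nonneg (fun j => hu j x) τ)
          (Ne.symm (right_ne_zero_of_mul (ne_of_gt h)))
      · exact Finset.mem_insert_self _ _
  · rintro (τ | _)
    · have h : Continuous fun p : unitInterval × S => chainWeight (fun j => u j p.2) τ :=
        (continuous_chainWeight τ).comp (continuous_pi fun j => by fun_prop)
      simp only [Sum.elim_inl]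
      fun_prop
    · simp only [Sum.elim_inr]
      fun_prop
  · intro x
    rw [ContinuousMap.coe_mk, ofWeights_val,
      ← weightCoord_sumElim_zero_right G fun _ : Unit => G ∅]
    congr 1
    funext k
    rcases k with τ | _ <;> simp
  · intro x
    rw [ContinuousMap.const_apply, ofWeights_val,
      ← weightCoord_sumElim_zero_left G fun _ : Unit => G ∅]
    congr 1
    funext k
    rcases k with τ | _ <;> simp

/-- A map into the realization that has a simplicial approximation by a partition of order at
most `n` is nullhomotopic if any `n` vertices are joined to a common vertex of `σ`. -/
theorem nullhomotopic_of_order_le [CompactSpace S] (hnm : n ≤ m)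
    (hσ : Δ.IsPseudosimplex m σ) (hflag : Δ.IsFlagWithRespectTo m σ)
    (hadj : ∀ T : Finset V, T.card ≤ n → ∃ w ∈ σ, ∀ v ∈ T, {v, w} ∈ Δ)
    (hu0 : ∀ j x, 0 ≤ u j x) (hu1 : ∀ j x, u j x ≤ 1) (hupos : ∀ x, ∃ j, 0 < u j x)
    (hord : ∀ x, (Finset.univ.filter fun j => 0 < u j x).card ≤ n)
    (hv : ∀ j x, 0 < u j x → v j ∈ (f x).1.support) : f.Nullhomotopic := by
  -- Sets with more than `n` indices never receive positive weight, so any vertex of `σ` will do for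
  -- them.
  have hex : ∀ τ : Finset J, ∃ w ∈ σ, τ.card ≤ n → ∀ j ∈ τ, {v j, w} ∈ Δ := by
    intro τ
    by_cases hτ : τ.card ≤ n
    · obtain ⟨w, hw, h⟩ := hadj (τ.image v) (Finset.card_image_le.trans hτ)
      exact ⟨w, hw, fun _ j hj => h _ (Finset.mem_image_of_mem v hj)⟩
    · obtain ⟨w, hw, -⟩ := hadj ∅ (by simp)
      exact ⟨w, hw, fun h => absurd h hτ⟩
  choose G hG hGv using hex
  have hu : ∀ x, Δ.IsWeight v fun j => u j x := fun x =>
    ⟨fun j => hu0 j x, hupos x, _, (f x).2.2.2, fun j => hv j x⟩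
  have hc : ∀ x, Δ.IsWeight G (chainWeight fun j => u j x) := by
    intro x
    refine ⟨chainWeight_nonneg fun j => hu0 j x,
      exists_chainWeight_pos (fun j => hu0 j x) (hupos x),
      (Finset.univ.filter fun τ => 0 < chainWeight (fun j => u j x) τ).image G, ?_, ?_⟩
    · refine hσ _ ?_ ?_ ?_
      · intro w hw
        obtain ⟨τ, -, rfl⟩ := Finset.mem_image.1 hw
        exact hG τ
      · obtain ⟨τ, hτ⟩ := exists_chainWeight_pos (fun j => hu0 j x) (hupos x)
        exact ⟨G τ, Finset.mem_image_of_mem G (Finset.mem_filter.2 ⟨Finset.mem_univ τ, hτ⟩)⟩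
      · refine Finset.card_image_le.trans ((card_chain_le (p := 0) (fun τ hτ τ' hτ' =>
          chainWeight_subset_or_subset (fun j => hu0 j x)
          (Finset.mem_filter.1 hτ).2 (Finset.mem_filter.1 hτ').2) (fun τ _ => Nat.zero_le _)
          fun τ hτ => (Finset.card_le_card fun j hj => Finset.mem_filter.2 ⟨Finset.mem_univ j,
            ((chainWeight_pos_iff fun j => hu0 j x).1 (Finset.mem_filter.1 hτ).2).2.1 j
              hj⟩).trans (hord x)).trans (by omega))
    · intro τ hτ
      exact Finset.mem_image_of_mem G (Finset.mem_filter.2 ⟨Finset.mem_univ τ, hτ⟩)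
  obtain ⟨y, hy⟩ := nullhomotopic_chainWeight hnm hσ hG hu0 hord hc
  exact ⟨y, (homotopic_simplicialApproximation hu hv).trans
    ((homotopic_chainWeight hnm hflag hG hGv hu hu1 hord hc).trans hy)⟩

end Contraction

end AbstractSimplicialComplex

/-! ### Bump functions of the Kuhn triangulation. -/

section Hat

/-- A bump function around a vertex of the Kuhn triangulation of `ℝ^ι`: it is positive exactly
on the open star of the origin. -/
noncomputable def kuhnHat {ι : Type*} [Fintype ι] (y : ι → ℝ) : ℝ :=
  (∏ i, max (1 - |y i|) 0) * ∏ i, ∏ j, max (1 - |y i - y j|) 0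

variable {ι : Type*} [Fintype ι]

theorem kuhnHat_nonneg (y : ι → ℝ) : 0 ≤ kuhnHat y :=
  mul_nonneg (Finset.prod_nonneg fun _ _ => le_max_right _ _)
    (Finset.prod_nonneg fun _ _ => Finset.prod_nonneg fun _ _ => le_max_right _ _)

theorem kuhnHat_le_one (y : ι → ℝ) : kuhnHat y ≤ 1 := by
  have h : ∀ r : ℝ, max (1 - |r|) 0 ≤ 1 := fun r =>
    max_le (sub_le_self _ (abs_nonneg r)) zero_le_one
  refine mul_le_one₀ (Finset.prod_le_one (fun _ _ => le_max_right _ _) fun i _ => h _)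
    (Finset.prod_nonneg fun _ _ => Finset.prod_nonneg fun _ _ => le_max_right _ _) ?_
  exact Finset.prod_le_one (fun _ _ => Finset.prod_nonneg fun _ _ => le_max_right _ _)
    fun i _ => Finset.prod_le_one (fun _ _ => le_max_right _ _) fun j _ => h _

theorem kuhnHat_pos_iff {y : ι → ℝ} :
    0 < kuhnHat y ↔ (∀ i, |y i| < 1) ∧ ∀ i j, |y i - y j| < 1 := by
  have h : ∀ r : ℝ, max (1 - |r|) 0 ≠ 0 ↔ |r| < 1 := by
    intro r
    rw [ne_eq, max_eq_right_iff, not_le, sub_pos]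
  rw [(kuhnHat_nonneg y).lt_iff_ne', kuhnHat]
  simp only [mul_ne_zero_iff, Finset.prod_ne_zero_iff, h, Finset.mem_univ, true_imp_iff]

theorem continuous_kuhnHat : Continuous (kuhnHat : (ι → ℝ) → ℝ) := by
  unfold kuhnHat
  fun_prop

theorem kuhnHat_sub_floor_pos (x : ι → ℝ) : 0 < kuhnHat fun i => x i - ⌊x i⌋ := by
  have h0 := fun i => Int.fract_nonneg (x i)
  have h1 := fun i => Int.fract_lt_one (x i)
  simp only [Int.self_sub_floor]
  refine kuhnHat_pos_iff.2 ⟨fun i => ?_, fun i j => ?_⟩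
  · rw [abs_of_nonneg (h0 i)]
    exact h1 i
  · rw [abs_lt]
    constructor <;> linarith [h0 i, h0 j, h1 i, h1 j]

/-- If `p` exceeds `q` at `i` and `q` exceeds `p` at `j`, the two integer gaps total at least `2`.
Adding the bounds on coordinate differences for `p` and `q` makes this total less than `2`. -/
theorem le_or_le_of_kuhnHat_pos {x : ι → ℝ} {p q : ι → ℤ}
    (hp : 0 < kuhnHat fun i => x i - p i) (hq : 0 < kuhnHat fun i => x i - q i) :
    p ≤ q ∨ q ≤ p := by
  by_contra! h
  simp only [Pi.le_def, not_forall, not_le] at h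
  obtain ⟨⟨i, hi⟩, j, hj⟩ := h
  have h1 := (abs_lt.1 ((kuhnHat_pos_iff.1 hp).2 j i)).2
  have h2 := (abs_lt.1 ((kuhnHat_pos_iff.1 hq).2 i j)).2
  have hi' : (q i : ℝ) + 1 ≤ p i := by exact_mod_cast hi
  have hj' : (p j : ℝ) + 1 ≤ q j := by exact_mod_cast hj
  linarith

/-- A point of `ℝ^ι` with an integral coordinate lies in at most `|ι|` open stars of vertices
of the Kuhn triangulation. -/
theorem card_le_of_kuhnHat_pos {x : ι → ℝ} {i₀ : ι} {z : ℤ} (hz : x i₀ = z)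
    (P : Finset (ι → ℤ)) (hP : ∀ p ∈ P, 0 < kuhnHat fun i => x i - p i) :
    P.card ≤ Fintype.card ι := by
  have hb : ∀ p ∈ P, ∀ i, ⌊x i⌋ ≤ p i ∧ p i ≤ ⌊x i⌋ + 1 := by
    intro p hp i
    have h := abs_lt.1 ((kuhnHat_pos_iff.1 (hP p hp)).1 i)
    have h1 := Int.floor_le (x i)
    have h2 := Int.lt_floor_add_one (x i)
    constructor
    · have : (⌊x i⌋ : ℝ) < p i + 1 := by linarith
      exact Int.lt_add_one_iff.1 (by exact_mod_cast this)
    · have : (p i : ℝ) < ⌊x i⌋ + 1 + 1 := by linarith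
      exact Int.lt_add_one_iff.1 (by exact_mod_cast this)
  have hb₀ : ∀ p ∈ P, p i₀ < ⌊x i₀⌋ + 1 := by
    intro p hp
    have h := abs_lt.1 ((kuhnHat_pos_iff.1 (hP p hp)).1 i₀)
    rw [hz, Int.floor_intCast]
    have : (p i₀ : ℝ) < z + 1 := by linarith
    exact_mod_cast this
  -- The points of `P` form a chain, so they are told apart by their coordinate sums. The integral
  -- coordinate forces `p i₀ < ⌊x i₀⌋ + 1`, which excludes the top value and leaves `|ι|` sums.
  have hcard : (Finset.Ico (∑ i, ⌊x i⌋) (∑ i, (⌊x i⌋ + 1))).card = Fintype.card ι := by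
    rw [Int.card_Ico, Finset.sum_add_distrib, add_sub_cancel_left]
    simp
  rw [← hcard]
  refine Finset.card_le_card_of_injOn (fun p => ∑ i, p i) (fun p hp => ?_) ?_
  · exact Finset.mem_coe.2 (Finset.mem_Ico.2 ⟨Finset.sum_le_sum fun i _ => (hb p hp i).1,
      Finset.sum_lt_sum (fun i _ => (hb p hp i).2) ⟨i₀, Finset.mem_univ _, hb₀ p hp⟩⟩)
  · intro p hp q hq hpq
    have key : ∀ p q : ι → ℤ, p ≤ q → ∑ i, p i = ∑ i, q i → p = q := fun p q hle h =>
      funext fun i => (Finset.sum_eq_sum_iff_of_le fun i _ => hle i).1 h i (Finset.mem_univ i)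
    rcases le_or_le_of_kuhnHat_pos (hP p hp) (hP q hq) with h | h
    · exact key p q h hpq
    · exact (key q p h hpq.symm).symm

end Hat

/-! ### Simplicial approximation on the boundary of the cube. -/

namespace AbstractSimplicialComplex

variable {V : Type*} [DecidableEq V] {Δ : AbstractSimplicialComplex V}

theorem nullhomotopic_of_sphere_pi {m n : ℕ} {σ : Finset V} (hnm : n ≤ m)
    (hσ : Δ.IsPseudosimplex m σ) (hflag : Δ.IsFlagWithRespectTo m σ)
    (hadj : ∀ T : Finset V, T.card ≤ n → ∃ w ∈ σ, ∀ v ∈ T, {v, w} ∈ Δ)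
    (f : C(Metric.sphere (0 : Fin n → ℝ) 1, Δ.Realization)) : f.Nullhomotopic := by
  classical
  obtain ⟨w₀, hw₀, -⟩ := hadj ∅ (by simp)
  obtain ⟨δ, hδ, hball⟩ := lebesgue_number_lemma_of_metric
    (c := fun w : V => {x | 0 < (f x).1 w}) isCompact_univ
    (fun w => isOpen_lt continuous_const ((Δ.continuous_coord w).comp f.continuous))
    (fun x _ => by
      obtain ⟨w, hw⟩ := (Δ.isRelLowerSet_faces (f x).2.2.2).1
      exact Set.mem_iUnion.2 ⟨w, lt_of_le_of_ne ((f x).2.1 w)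
        (Ne.symm (Finsupp.mem_support_iff.1 hw))⟩)
  -- Two points under one bump function differ by less than `2 / N` in each coordinate, hence are
  -- within the Lebesgue number `δ` of the cover by preimages of open vertex stars.
  obtain ⟨N, hN⟩ := exists_nat_gt (2 / δ)
  have hN0 : (0 : ℝ) < N := (div_pos two_pos hδ).trans hN
  have hx1 : ∀ (x : Metric.sphere (0 : Fin n → ℝ) 1) i, |x.1 i| ≤ 1 := fun x i => by
    rw [← Real.norm_eq_abs]
    exact (norm_le_pi_norm x.1 i).trans (by simp)
  let J := Fintype.piFinset fun _ : Fin n => Finset.Icc (-(N : ℤ)) N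
  let u : J → C(Metric.sphere (0 : Fin n → ℝ) 1, ℝ) := fun p =>
    ⟨fun x => kuhnHat fun i => N * x.1 i - p.1 i, continuous_kuhnHat.comp
      (continuous_pi fun i => (continuous_const.mul
        ((continuous_apply i).comp continuous_subtype_val)).sub continuous_const)⟩
  have hdist : ∀ p x y, 0 < u p x → 0 < u p y → dist y x < δ := by
    intro p x y hx hy
    rw [Subtype.dist_eq, dist_pi_lt_iff hδ]
    intro i
    have h1 := abs_lt.1 ((kuhnHat_pos_iff.1 hx).1 i)
    have h2 := abs_lt.1 ((kuhnHat_pos_iff.1 hy).1 i)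
    rw [div_lt_iff₀ hδ] at hN
    rw [Real.dist_eq, abs_lt]
    constructor <;> nlinarith
  have hv : ∀ p, ∃ w, ∀ x, 0 < u p x → w ∈ (f x).1.support := by
    intro p
    by_cases h : ∃ x, 0 < u p x
    · obtain ⟨x, hx⟩ := h
      obtain ⟨w, hw⟩ := hball x trivial
      exact ⟨w, fun y hy => Finsupp.mem_support_iff.2
        (ne_of_gt (hw (Metric.mem_ball.2 (hdist p x y hx hy))))⟩
    -- A bump function vanishing on the whole sphere gets an arbitrary vertex.
    · exact ⟨w₀, fun x hx => absurd ⟨x, hx⟩ h⟩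
  choose v hv using hv
  refine nullhomotopic_of_order_le (u := u) (v := v) hnm hσ hflag hadj
    (fun p x => kuhnHat_nonneg _) (fun p x => kuhnHat_le_one _) ?_ ?_ hv
  · intro x
    refine ⟨⟨fun i => ⌊N * x.1 i⌋, Fintype.mem_piFinset.2 fun i => Finset.mem_Icc.2 ⟨?_, ?_⟩⟩,
      kuhnHat_sub_floor_pos fun i => N * x.1 i⟩
    · rw [Int.le_floor]
      push_cast
      nlinarith [(abs_le.1 (hx1 x i)).1]
    · have h := Int.floor_le ((N : ℝ) * x.1 i)
      have : (⌊(N : ℝ) * x.1 i⌋ : ℝ) ≤ N := by nlinarith [(abs_le.1 (hx1 x i)).2]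
      exact_mod_cast this
  · intro x
    -- On the sup-norm sphere some coordinate is `±1`, so its multiple by `N` is an integer; this
    -- lowers the order from `n + 1` to `n`.
    obtain ⟨i₀, hi₀⟩ : ∃ i, |x.1 i| = 1 := by
      by_contra! h
      have h2 : ‖x.1‖ < 1 := (pi_norm_lt_iff one_pos).2 fun i => lt_of_le_of_ne (hx1 x i) (h i)
      simp at h2
    have hz : ∃ z : ℤ, (N : ℝ) * x.1 i₀ = z := by
      rcases (abs_eq zero_le_one).1 hi₀ with h | h
      · exact ⟨N, by simp [h]⟩
      · exact ⟨-N, by simp [h]⟩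
    obtain ⟨z, hz⟩ := hz
    rw [← Finset.card_map (Function.Embedding.subtype _)]
    refine (card_le_of_kuhnHat_pos (x := fun i => N * x.1 i) hz _ ?_).trans_eq
      (Fintype.card_fin n)
    intro p hp
    obtain ⟨q, hq, rfl⟩ := Finset.mem_map.1 hp
    exact (Finset.mem_filter.1 hq).2

end AbstractSimplicialComplex

/-! ### From spheres to balls. -/

/-- The radial homeomorphism between two spheres, as a continuous map. -/
noncomputable def radialSphereMap {E F : Type*} [NormedAddCommGroup E] [NormedSpace ℝ E]
    [NormedAddCommGroup F] [NormedSpace ℝ F] (e : E ≃L[ℝ] F) :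
    C(Metric.sphere (0 : E) 1, Metric.sphere (0 : F) 1) where
  toFun x := ⟨‖e x.1‖⁻¹ • e x.1, by
    have hx : e x.1 ≠ 0 := e.map_ne_zero_iff.2 (ne_zero_of_mem_unit_sphere x)
    simp [norm_smul, inv_mul_cancel₀ (norm_ne_zero_iff.2 hx)]⟩
  continuous_toFun := by
    have hx : ∀ x : Metric.sphere (0 : E) 1, ‖e x.1‖ ≠ 0 := fun x =>
      norm_ne_zero_iff.2 (e.map_ne_zero_iff.2 (ne_zero_of_mem_unit_sphere x))
    fun_prop (disch := exact hx _)

theorem radialSphereMap_symm_apply {E F : Type*} [NormedAddCommGroup E] [NormedSpace ℝ E]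
    [NormedAddCommGroup F] [NormedSpace ℝ F] (e : E ≃L[ℝ] F) (x : Metric.sphere (0 : E) 1) :
    radialSphereMap e.symm (radialSphereMap e x) = x := by
  have hx : ‖e x.1‖ ≠ 0 :=
    norm_ne_zero_iff.2 (e.map_ne_zero_iff.2 (ne_zero_of_mem_unit_sphere x))
  apply Subtype.ext
  simp [radialSphereMap, norm_smul, smul_smul, hx]

/-- A nullhomotopic map from the unit sphere extends to the unit ball. -/
theorem ContinuousMap.Nullhomotopic.exists_extension_closedBall {E X : Type*}
    [NormedAddCommGroup E] [NormedSpace ℝ E] [FiniteDimensional ℝ E] [Nontrivial E]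
    [TopologicalSpace X] {f : C(Metric.sphere (0 : E) 1, X)} (hf : f.Nullhomotopic) :
    ∃ g : C(Metric.closedBall (0 : E) 1, X), ∀ x : Metric.sphere (0 : E) 1,
      g ⟨x.1, Metric.sphere_subset_closedBall x.2⟩ = f x := by
  have : ProperSpace E := FiniteDimensional.proper ℝ E
  obtain ⟨y, ⟨H⟩⟩ := hf
  have hnorm : ∀ (t : unitInterval) (x : Metric.sphere (0 : E) 1),
      ‖(1 - (t : ℝ)) • x.1‖ = 1 - t := fun t x => by
    rw [norm_smul, norm_eq_of_mem_sphere x, mul_one, Real.norm_eq_abs,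
      abs_of_nonneg (sub_nonneg.2 t.2.2)]
  let q : C(unitInterval × Metric.sphere (0 : E) 1, Metric.closedBall (0 : E) 1) :=
    ⟨fun p => ⟨(1 - (p.1 : ℝ)) • p.2.1, by
      rw [mem_closedBall_zero_iff, hnorm]
      exact sub_le_self _ p.1.2.1⟩, by fun_prop⟩
  have hsurj : Function.Surjective q := by
    intro b
    have hb : ‖b.1‖ ≤ 1 := mem_closedBall_zero_iff.1 b.2
    let t : unitInterval := ⟨1 - ‖b.1‖, sub_nonneg.2 hb, sub_le_self _ (norm_nonneg _)⟩
    by_cases h0 : b.1 = 0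
    · obtain ⟨x, hx⟩ := NormedSpace.sphere_nonempty (E := E) (x := 0) (r := 1) |>.2 zero_le_one
      exact ⟨(t, ⟨x, hx⟩), Subtype.ext (by simp [q, t, h0])⟩
    · exact ⟨(t, ⟨‖b.1‖⁻¹ • b.1, by
        simp [norm_smul, inv_mul_cancel₀ (norm_ne_zero_iff.2 h0)]⟩),
        Subtype.ext (by simp [q, t, smul_smul, mul_inv_cancel₀ (norm_ne_zero_iff.2 h0)])⟩
  -- The ball is the cylinder over the sphere with its end `t = 1` collapsed; the homotopy is
  -- constant there and so descends.
  have hq : Topology.IsQuotientMap q := q.continuous.isClosedMap.isQuotientMap q.continuous hsurj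
  have hfac : ∀ a b, q a = q b → H a = H b := by
    rintro ⟨t, x⟩ ⟨t', x'⟩ h
    have h1 : (1 - (t : ℝ)) • x.1 = (1 - (t' : ℝ)) • x'.1 := congrArg Subtype.val h
    have h2 : t = t' := by
      have := congrArg norm h1
      rw [hnorm, hnorm] at this
      exact Subtype.ext (by linarith)
    subst h2
    by_cases ht : t = 1
    · subst ht
      simp
    · have h3 : (1 - (t : ℝ)) ≠ 0 := fun h => ht (Subtype.ext (sub_eq_zero.1 h).symm)
      rw [Subtype.ext (smul_right_injective E h3 h1)]
  refine ⟨hq.lift H.toContinuousMap hfac, fun x => ?_⟩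
  have h0 : q (0, x) = ⟨x.1, Metric.sphere_subset_closedBall x.2⟩ := Subtype.ext (by simp [q])
  rw [← h0]
  refine (DFunLike.congr_fun (hq.lift_comp H.toContinuousMap hfac) (0, x)).trans ?_
  exact H.map_zero_left x

/-! ### Counting common neighbours, and the conclusion. -/

namespace AbstractSimplicialComplex

/-- If every vertex is joined to all but `k` vertices of `σ`, then any `n` vertices are joined to
a common vertex of `σ`, provided `n * k < |σ|`. -/
theorem exists_common_neighbor {V : Type*} [DecidableEq V] {Δ : AbstractSimplicialComplex V}
    {m k n : ℕ} (hm : 1 ≤ m) {σ : Finset V} (hcard : n * k < σ.card)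
    (hjoin : ∀ v : V, ∃ τ ⊆ σ, σ.card ≤ τ.card + k ∧ Δ.Joinable m {v} τ)
    (T : Finset V) (hT : T.card ≤ n) : ∃ w ∈ σ, ∀ v ∈ T, {v, w} ∈ Δ := by
  choose τ hτ hτc hτj using hjoin
  -- Each vertex of `T` rules out at most `k` vertices of `σ`.
  have h1 : (T.biUnion fun v => σ \ τ v).card ≤ T.card * k :=
    Finset.card_biUnion_le_card_mul _ _ _ fun v _ => by
      rw [Finset.card_sdiff_of_subset (hτ v)]
      have := hτc v
      omega
  obtain ⟨w, hw, hwn⟩ := Finset.exists_mem_notMem_of_card_lt_card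
    ((h1.trans (Nat.mul_le_mul_right k hT)).trans_lt hcard)
  refine ⟨w, hw, fun v hv => ?_⟩
  have hwτ : w ∈ τ v := by
    by_contra h
    exact hwn (Finset.mem_biUnion.2 ⟨v, hv, Finset.mem_sdiff.2 ⟨hw, h⟩⟩)
  -- The pair has at most `2 ≤ m + 1` elements; this is where `1 ≤ m` enters.
  refine hτj v _ ?_ (Finset.insert_nonempty _ _) (Finset.card_le_two.trans (by omega))
  intro z hz
  rcases Finset.mem_insert.1 hz with rfl | hz
  · simp
  · rw [Finset.mem_singleton.1 hz]
    exact Finset.mem_union_right _ hwτ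

end AbstractSimplicialComplex

theorem mainTheorem11 {V : Type*} [DecidableEq V] (Δ : AbstractSimplicialComplex V)
    (m k : ℕ) (hk : 1 ≤ k) (l : ℤ) (σ : Finset V)
    (hσ : Δ.IsPseudosimplexOfDim m l σ)
    (hflag : Δ.IsFlagWithRespectTo m σ)
    (hjoin : ∀ v : V, ∃ τ : Finset V, τ ⊆ σ ∧ (τ.card : ℤ) = (l - k) + 1 ∧
      Δ.Joinable m {v} τ) :
    IsNConnected (min (⌊(l : ℚ) / (k : ℚ)⌋ - 1) ((m : ℤ) - 1)) Δ.Realization := by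
  obtain ⟨hl, hσm⟩ := hσ
  have hkq : (0 : ℚ) < k := by exact_mod_cast hk
  have hfloor : ∀ z : ℤ, z ≤ min (⌊(l : ℚ) / (k : ℚ)⌋ - 1) ((m : ℤ) - 1) →
      (z + 1) * k ≤ l ∧ z + 1 ≤ m := by
    intro z hz
    obtain ⟨h1, h2⟩ := le_min_iff.1 hz
    have h3 := Int.le_floor.1 (le_sub_iff_add_le.1 h1)
    rw [le_div_iff₀ hkq] at h3
    exact ⟨by exact_mod_cast h3, by omega⟩
  refine ⟨fun h => ?_, fun i hi f => ?_⟩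
  · have hl0 := (hfloor _ h).1
    obtain ⟨w, -⟩ : σ.Nonempty := Finset.card_pos.1 (by omega)
    exact ⟨AbstractSimplicialComplex.ofWeights (v := fun _ : Unit => w) (fun _ => 1)
      ⟨fun _ => zero_le_one, ⟨(), one_pos⟩, {w}, Δ.singleton_mem _, by simp⟩⟩
  · obtain ⟨h1, h2⟩ := hfloor _ hi
    have hnm : i + 1 ≤ m := by omega
    have hcard : (i + 1) * k < σ.card := by
      zify
      omega
    have hadj := AbstractSimplicialComplex.exists_common_neighbor (Δ := Δ) (m := m) (n := i + 1) (by omega) hcard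
      (fun v => by
        obtain ⟨τ, hτ, hc, hj⟩ := hjoin v
        exact ⟨τ, hτ, by omega, hj⟩)
    -- The Euclidean sphere is exchanged for the sup-norm sphere, which is compatible with the
    -- integer grid.
    let e := PiLp.continuousLinearEquiv 2 ℝ fun _ : Fin (i + 1) => ℝ
    have hnull := (AbstractSimplicialComplex.nullhomotopic_of_sphere_pi hnm hσm hflag
      hadj (f.comp (radialSphereMap e.symm))).comp_left (radialSphereMap e)
    have hf : (f.comp (radialSphereMap e.symm)).comp (radialSphereMap e) = f := by
      ext1 x
      exact congrArg f (radialSphereMap_symm_apply e x)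
    rw [hf] at hnull
    exact hnull.exists_extension_closedBall
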